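/- **Corollary 1.4** (cor:weinstein). For $\alpha>0$ let $X_\alpha=(S^2\times S^2,\omega_\alpha)$ with $\omega_\alpha=2(\alpha+1)\,\omega_{S^2}\oplus 2\alpha\,\omega_{S^2}$, where $\omega_{S^2}$ is the rotation invariant area form of total area $1$ on the unit sphere $S^2\subset\mathbb R^3$. For $a>0$ and $h\in(-\tfrac a2,\tfrac a2)$ let $S^1_h\subset(S^2,a\,\omega_{S^2})$ be the circle of constant height such that the annulus bounded by the equator and $S^1_h$ has signed area $h$. A *split torus* in $X_\alpha$ is a torus $T(x,y)=S^1_x\times S^1_y$ with $(x,y)\in(-1-\alpha,1+\alpha)\times(-\alpha,\alpha)$. Write $L\cong L'$ if $L'=\phi(L)$ for the time-one map $\phi$ of the flow of a smooth time-dependent Hamiltonian on $X_\alpha$. A *Weinstein neighbourhood* of a Lagrangian torus $L\subset X_\alpha$ is an open set $W\subset X_\alpha$ that is the image of an open neighbourhood of the zero section of $T^*L$ (with its canonical symplectic form) under a symplectic embedding that restricts to the inclusion $L\hookrightarrow X_\alpha$ on the zero section. Then for every $\alpha>0$ there is a split torus $L\subset X_\alpha$ such that every Weinstein neighbourhood of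 $L$ contains a split torus, and indeed infinitely many split tori, $L'$ with $L\cong L'$ and $L\cap L'=\varnothing$. -/

import Mathlib

open scoped Manifold ContDiff

noncomputable section

/-! ### The symplectic manifold `S² × S²` -/

/-- Euclidean three-space. -/
abbrev E3 : Type := EuclideanSpace ℝ (Fin 3)

/-- The unit sphere `S² ⊂ ℝ³`, with its standard smooth structure from Mathlib. -/
abbrev S2 : Type := Metric.sphere (0 : EuclideanSpace ℝ (Fin (2 + 1))) 1

/-- The smooth manifold underlying `X_α`. -/
abbrev S2xS2 : Type := S2 × S2

/-- The model with corners of `S² × S²`. -/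
abbrev modelX : ModelWithCorners ℝ
    (EuclideanSpace ℝ (Fin 2) × EuclideanSpace ℝ (Fin 2))
    (ModelProd (EuclideanSpace ℝ (Fin 2)) (EuclideanSpace ℝ (Fin 2))) :=
  (𝓡 2).prod (𝓡 2)

/-- The expression `det (p, u, v) / (4π)`. For `p` on the unit sphere and `u, v` tangent to the
sphere at `p`, this is the rotation invariant area form of total area `1`. -/
def ambientAreaForm (p u v : E3) : ℝ :=
  (Matrix.of ![(p : Fin 3 → ℝ), (u : Fin 3 → ℝ), (v : Fin 3 → ℝ)]).det / (4 * Real.pi)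

/-- The area form `ω_{S²}` on the sphere, of total area `1`: abstract tangent vectors are viewed
in `ℝ³` through the differential of the inclusion. -/
def sphereAreaForm (p : S2) (u v : TangentSpace (𝓡 2) p) : ℝ :=
  ambientAreaForm (p : E3)
    (mvfderiv (𝓡 2) (fun q : S2 => (q : E3)) p u)
    (mvfderiv (𝓡 2) (fun q : S2 => (q : E3)) p v)

/-- The symplectic form `ω_α = 2(α + 1) ω_{S²} ⊕ 2α ω_{S²}` on `S² × S²`. -/
def omega (α : ℝ) (p : S2xS2) (u v : TangentSpace modelX p) : ℝ :=
  2 * (α + 1) * sphereAreaForm p.1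
      (mfderiv modelX (𝓡 2) Prod.fst p u) (mfderiv modelX (𝓡 2) Prod.fst p v)
    + 2 * α * sphereAreaForm p.2
      (mfderiv modelX (𝓡 2) Prod.snd p u) (mfderiv modelX (𝓡 2) Prod.snd p v)

/-! ### Circles of constant height and split tori -/

/-- Cylindrical coordinates (angle, height) on the unit sphere. -/
def cylPoint (θ t : ℝ) : E3 :=
  !₂[Real.sqrt (1 - t ^ 2) * Real.cos θ, Real.sqrt (1 - t ^ 2) * Real.sin θ, t]

/-- The signed area, with respect to `a ω_{S²}`, of the annulus bounded by the equator and the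
circle at Euclidean height `z ∈ [-1, 1]`, as an integral in cylindrical coordinates. -/
def annulusArea (a z : ℝ) : ℝ :=
  ∫ t in (0 : ℝ)..z, ∫ θ in (0 : ℝ)..(2 * Real.pi),
    a * ambientAreaForm (cylPoint θ t)
      (deriv (fun s => cylPoint s t) θ) (deriv (fun s => cylPoint θ s) t)

/-- The circle `S¹_h` in `(S², a ω_{S²})`: the points at the constant height for which
the annulus between the equator and the circle has signed area `h`. -/
def heightCircle (a h : ℝ) : Set S2 :=
  {p | annulusArea a ((p : E3) 2) = h}

/-- The torus `T(x, y) = S¹_x × S¹_y ⊂ X_α`. -/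
def splitTorus (α x y : ℝ) : Set S2xS2 :=
  heightCircle (2 * (α + 1)) x ×ˢ heightCircle (2 * α) y

/-- Split tori in `X_α`. -/
def IsSplitTorus (α : ℝ) (L : Set S2xS2) : Prop :=
  ∃ x ∈ Set.Ioo (-1 - α) (1 + α), ∃ y ∈ Set.Ioo (-α) α, L = splitTorus α x y

/-! ### Hamiltonian isotopies -/

/-- `φ` is the Hamiltonian flow on `X_α` of the smooth time-dependent Hamiltonian `H`:
`φ_0 = id` and `ω_α (d/dt φ_t(p), ·) = dH_t` at `φ_t(p)`. -/
structure IsHamiltonianFlow (α : ℝ) (H : ℝ × S2xS2 → ℝ) (φ : ℝ → S2xS2 → S2xS2) : Prop where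
  smooth : ContMDiff (𝓘(ℝ, ℝ).prod modelX) 𝓘(ℝ, ℝ) ∞ H
  zero : ∀ p, φ 0 p = p
  differentiable : ∀ p, MDifferentiable 𝓘(ℝ, ℝ) modelX (fun t => φ t p)
  equation : ∀ (t : ℝ) (p : S2xS2) (v : TangentSpace modelX (φ t p)),
    omega α (φ t p) (mfderiv 𝓘(ℝ, ℝ) modelX (fun s => φ s p) t (1 : ℝ)) v
      = mvfderiv modelX (fun q => H (t, q)) (φ t p) v

/-- `L ≅ L'`: the subset `L` is mapped to `L'` by the time-one map of a Hamiltonian flow. -/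
def HamIsotopic (α : ℝ) (L L' : Set S2xS2) : Prop :=
  ∃ (H : ℝ × S2xS2 → ℝ) (φ : ℝ → S2xS2 → S2xS2), IsHamiltonianFlow α H φ ∧ φ 1 '' L = L'

/-! ### Weinstein neighbourhoods of tori -/

/-- The cotangent bundle `T*𝕋² = 𝕋² × ℝ²` of the two-torus, trivialised by the angular forms
`dq₁, dq₂`; the point `((z₁, z₂), (p₁, p₂))` is the covector `p₁ dq₁ + p₂ dq₂` at `(z₁, z₂)`. -/
abbrev CotangentT2 : Type := (Circle × Circle) × (ℝ × ℝ)

/-- The model with corners of `T*𝕋²`. -/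
abbrev modelT : ModelWithCorners ℝ
    ((EuclideanSpace ℝ (Fin 1) × EuclideanSpace ℝ (Fin 1)) × (ℝ × ℝ))
    (ModelProd (ModelProd (EuclideanSpace ℝ (Fin 1)) (EuclideanSpace ℝ (Fin 1))) (ℝ × ℝ)) :=
  ((𝓡 1).prod (𝓡 1)).prod 𝓘(ℝ, ℝ × ℝ)

/-- The angular form on the unit circle: on `d/dt (z e^{it})` it takes the value `1`. -/
def angularForm (z : Circle) (u : TangentSpace (𝓡 1) z) : ℝ :=
  ((starRingEnd ℂ) (z : ℂ) *
    mvfderiv (𝓡 1) (fun w : Circle => (w : ℂ)) z u).im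

/-- The form `dq₁` on `T*𝕋²`. -/
def dq₁ (c : CotangentT2) (u : TangentSpace modelT c) : ℝ :=
  angularForm c.1.1 (mfderiv modelT (𝓡 1) (fun b : CotangentT2 => b.1.1) c u)

/-- The form `dq₂` on `T*𝕋²`. -/
def dq₂ (c : CotangentT2) (u : TangentSpace modelT c) : ℝ :=
  angularForm c.1.2 (mfderiv modelT (𝓡 1) (fun b : CotangentT2 => b.1.2) c u)

/-- The form `dp₁` on `T*𝕋²`. -/
def dp₁ (c : CotangentT2) (u : TangentSpace modelT c) : ℝ :=
  mvfderiv modelT (fun b : CotangentT2 => b.2.1) c u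

/-- The form `dp₂` on `T*𝕋²`. -/
def dp₂ (c : CotangentT2) (u : TangentSpace modelT c) : ℝ :=
  mvfderiv modelT (fun b : CotangentT2 => b.2.2) c u

/-- The canonical symplectic form `dp₁ ∧ dq₁ + dp₂ ∧ dq₂` on `T*𝕋²`. -/
def canonicalForm (c : CotangentT2) (u v : TangentSpace modelT c) : ℝ :=
  (dp₁ c u * dq₁ c v - dp₁ c v * dq₁ c u) + (dp₂ c u * dq₂ c v - dp₂ c v * dq₂ c u)

/-- The zero section of `T*𝕋²`. -/
def zeroSection : Set CotangentT2 := {c | c.2 = 0}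

/-- `W` is a Weinstein neighbourhood of the Lagrangian torus `L ⊂ X_α`: an open set that is the
image of an open neighbourhood `V` of the zero section under a symplectic embedding `Ψ` that maps
the zero section onto `L`. (The restriction of `Ψ` to the zero section is a diffeomorphism
`𝕋² → L`, and it induces the identification of `T*L` with `T*𝕋²`. The inverse of `Ψ` is smooth
since the differentials of `Ψ` preserve symplectic forms of the same dimension.) -/
def IsWeinsteinNhd (α : ℝ) (L W : Set S2xS2) : Prop :=
  ∃ (V : Set CotangentT2) (Ψ : CotangentT2 → S2xS2),
    IsOpen V ∧ zeroSection ⊆ V ∧ ContMDiffOn modelT modelX ∞ Ψ V ∧ Set.InjOn Ψ V ∧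
    (∀ c ∈ V, ∀ u v : TangentSpace modelT c,
      omega α (Ψ c) (mfderiv modelT modelX Ψ c u) (mfderiv modelT modelX Ψ c v)
        = canonicalForm c u v) ∧
    Ψ '' zeroSection = L ∧ Ψ '' V = W ∧ IsOpen W

/-! ### The circles `S¹_h` in terms of Euclidean height -/

theorem hasDerivAt_E3 {f : ℝ → E3} {v : E3} {t : ℝ}
    (h : ∀ i, HasDerivAt (fun s => f s i) (v i) t) : HasDerivAt f v t :=
  (PiLp.continuousLinearEquiv 2 ℝ (fun _ : Fin 3 => ℝ)).symm.hasFDerivAt.comp_hasDerivAt t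
    (hasDerivAt_pi.2 h)

theorem ambientAreaForm_cyl {t : ℝ} (ht : t ∈ Set.Ioo (-1 : ℝ) 1) (θ : ℝ) :
    ambientAreaForm (cylPoint θ t)
      (deriv (fun s => cylPoint s t) θ) (deriv (fun s => cylPoint θ s) t)
      = 1 / (4 * Real.pi) := by
  have hpos : 0 < 1 - t ^ 2 := by nlinarith [ht.1, ht.2]
  have h1 : HasDerivAt (fun s => cylPoint s t)
      !₂[Real.sqrt (1 - t ^ 2) * (-Real.sin θ), Real.sqrt (1 - t ^ 2) * Real.cos θ, 0] θ := by
    refine hasDerivAt_E3 fun i => ?_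
    fin_cases i
    · simpa [cylPoint] using (Real.hasDerivAt_cos θ).const_mul (Real.sqrt (1 - t ^ 2))
    · simpa [cylPoint] using (Real.hasDerivAt_sin θ).const_mul (Real.sqrt (1 - t ^ 2))
    · simpa [cylPoint] using hasDerivAt_const θ t
  obtain ⟨r, hr⟩ : ∃ r, HasDerivAt (fun s : ℝ => Real.sqrt (1 - s ^ 2)) r t ∧
      r * Real.sqrt (1 - t ^ 2) = -t := by
    have h := ((hasDerivAt_pow 2 t).const_sub 1).sqrt hpos.ne'
    refine ⟨_, h, ?_⟩
    have : Real.sqrt (1 - t ^ 2) ≠ 0 := (Real.sqrt_pos.2 hpos).ne'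
    field_simp
    simp
  have h2 : HasDerivAt (fun s => cylPoint θ s)
      !₂[r * Real.cos θ, r * Real.sin θ, 1] t := by
    refine hasDerivAt_E3 fun i => ?_
    fin_cases i
    · simpa [cylPoint] using hr.1.mul_const (Real.cos θ)
    · simpa [cylPoint] using hr.1.mul_const (Real.sin θ)
    · simpa [cylPoint] using hasDerivAt_id' t
  have hs : Real.sqrt (1 - t ^ 2) ^ 2 = 1 - t ^ 2 := Real.sq_sqrt hpos.le
  have hc : Real.sin θ ^ 2 = 1 - Real.cos θ ^ 2 := by
    linarith [Real.sin_sq_add_cos_sq θ]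
  rw [h1.deriv, h2.deriv, ambientAreaForm, Matrix.det_fin_three]
  congr 1
  simp [cylPoint]
  linear_combination (hs - t * hr.2) + (Real.sqrt (1 - t ^ 2) ^ 2 - t * (r * Real.sqrt (1 - t ^ 2))) * hc

theorem annulusArea_eq (a : ℝ) {z : ℝ} (hz : z ∈ Set.Icc (-1 : ℝ) 1) :
    annulusArea a z = a * z / 2 := by
  have : annulusArea a z = ∫ _t in (0 : ℝ)..z, a / 2 := by
    refine intervalIntegral.integral_congr_ae ?_
    have h0 : ∀ᵐ t : ℝ, t ≠ 1 := MeasureTheory.Measure.ae_ne MeasureTheory.volume 1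
    have h0' : ∀ᵐ t : ℝ, t ≠ -1 := MeasureTheory.Measure.ae_ne MeasureTheory.volume (-1)
    filter_upwards [h0, h0'] with t h1 h1' ht
    have ht' : t ∈ Set.Ioo (-1 : ℝ) 1 := by
      rw [Set.mem_uIoc] at ht
      rcases ht with ht | ht
      · exact ⟨by linarith, lt_of_le_of_ne (ht.2.trans hz.2) h1⟩
      · exact ⟨hz.1.trans_lt ht.1, by linarith⟩
    simp only [ambientAreaForm_cyl ht']
    rw [intervalIntegral.integral_const, smul_eq_mul]
    have := Real.pi_ne_zero
    field_simp
    ring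
  rw [this, intervalIntegral.integral_const, smul_eq_mul]
  ring

/-- The circle `S¹_h` in `(S², a ω_{S²})` lies at Euclidean height `2h/a`. -/
theorem mem_heightCircle_iff {a : ℝ} (ha : a ≠ 0) (h : ℝ) (p : S2) :
    p ∈ heightCircle a h ↔ (p : E3) 2 = 2 * h / a := by
  have hp : ((p : E3) 2) ∈ Set.Icc (-1 : ℝ) 1 := by
    have h1 : |(p : E3) 2| ≤ ‖(p : E3)‖ := by
      simpa using PiLp.norm_apply_le (p : E3) 2
    have h2 : ‖(p : E3)‖ = 1 := by simp
    rw [h2] at h1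
    exact abs_le.1 h1
  change annulusArea a ((p : E3) 2) = h ↔ _
  rw [annulusArea_eq a hp]
  rw [eq_div_iff ha]
  constructor <;> intro h <;> linarith

end

/-!
The split tori are the fibres of `(z₁, z₂) ↦ ((α + 1) z₁, α z₂)`, where `z₁, z₂` are the heights on
the two spheres. Writing `ζ₁, ζ₂` for the complex horizontal coordinates, the flow of a Hamiltonian
`f(z₁) g(z₂) Re (ζ₁ ζ₂)` moves the image point along lines of slope one (symmetric probes). For
suitable `f` and `g` this motion is harmonic on a given line, and the time-one map then reflects the
segment in which the line meets the moment rectangle in its midpoint. Together with rotations of the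
spheres this gives `T(x, y) ≅ T(± x, ± y)`, `T(x, y) ≅ T(x - 2y, -y)` if `|x - y| < 1`, and
`T(x, y) ≅ T(1 - y, 1 - x)` if `x - y > 1`. For `0 < y < α` these relations generate
`T(1, y) ≅ T(1 + s, y)` for `s ∈ 2ℤ + 2yℤ` with `|s| < y`. If `y` is irrational, the parameters `s`
are dense in `(-y, y)`, so every neighbourhood of `T(1, y)` contains infinitely many of these tori.
-/

noncomputable section

open NNReal Set Metric Topology

/-! ### Ordinary differential equations -/

theorem exists_forall_hasDerivAt_of_lipschitzWith {E : Type*} [NormedAddCommGroup E]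
    [NormedSpace ℝ E] [CompleteSpace E] {v : E → E} {K C : ℝ≥0} (hv : LipschitzWith K v)
    (hC : ∀ x, ‖v x‖ ≤ C) (x : E) :
    ∃ γ : ℝ → E, γ 0 = x ∧ ∀ t, HasDerivAt γ (v (γ t)) t := by
  have local_solution (T : ℝ≥0) :
      ∃ γ : ℝ → E, γ 0 = x ∧ ∀ t ∈ Ioo (-T : ℝ) T, HasDerivAt γ (v (γ t)) t := by
    have hT : (0 : ℝ) ∈ Icc (-T : ℝ) T := by simp
    have h : IsPicardLindelof (fun _ => v) (⟨0, hT⟩ : Icc (-T : ℝ) T) x (C * T) 0 C K :=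
      .of_time_independent (fun z _ => hC z) hv.lipschitzOnWith (by simp)
    obtain ⟨γ, h0, hγ⟩ := h.exists_eq_forall_mem_Icc_hasDerivWithinAt₀
    exact ⟨γ, h0, fun t ht =>
      (hγ t (Ioo_subset_Icc_self ht)).hasDerivAt (Icc_mem_nhds ht.1 ht.2)⟩
  choose γ h0 hγ using local_solution
  have agree {S T : ℝ≥0} (h : S ≤ T) : EqOn (γ S) (γ T) (Ioo (-S : ℝ) S) := by
    intro t ht
    have hS : (0 : ℝ) < S := neg_lt_self_iff.1 (ht.1.trans ht.2)
    have hST : Ioo (-S : ℝ) S ⊆ Ioo (-T : ℝ) T := Ioo_subset_Ioo (by simpa) (by simpa)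
    exact ODE_solution_unique_of_mem_Ioo (v := fun _ => v) (s := fun _ => univ)
      (fun _ _ => hv.lipschitzOnWith) (t₀ := 0) (by simpa)
      (fun s hs => ⟨hγ S s hs, mem_univ _⟩) (fun s hs => ⟨hγ T s (hST hs), mem_univ _⟩)
      ((h0 S).trans (h0 T).symm) ht
  have mem_Ioo (t : ℝ) {T : ℝ} (h : |t| < T) : t ∈ Ioo (-T) T := abs_lt.1 h
  refine ⟨fun t => γ (‖t‖₊ + 1) t, h0 _, fun t => ?_⟩
  have ht : t ∈ Ioo (-(‖t‖₊ + 1 : ℝ≥0) : ℝ) (‖t‖₊ + 1 : ℝ≥0) := mem_Ioo t (by simp)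
  refine (hγ _ t ht).congr_of_eventuallyEq ?_
  filter_upwards [Ioo_mem_nhds ht.1 ht.2] with s hs
  have hs' : s ∈ Ioo (-(‖s‖₊ + 1 : ℝ≥0) : ℝ) (‖s‖₊ + 1 : ℝ≥0) := mem_Ioo s (by simp)
  rcases le_total (‖s‖₊ + 1) (‖t‖₊ + 1) with h | h
  · exact agree h hs'
  · exact (agree h hs).symm

theorem is_const_of_hasDerivAt_zero {E : Type*} [NormedAddCommGroup E] [NormedSpace ℝ E]
    {u : ℝ → E} (hu : ∀ t, HasDerivAt u 0 t) (s t : ℝ) : u s = u t :=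
  is_const_of_deriv_eq_zero (fun t => (hu t).differentiableAt) (fun t => (hu t).deriv) s t

theorem apply_one_eq_neg_of_oscillator {u w : ℝ → ℝ} (hu : ∀ t, HasDerivAt u (w t) t)
    (hw : ∀ t, HasDerivAt w (-Real.pi ^ 2 * u t) t) : u 1 = -u 0 := by
  have h (t : ℝ) : HasDerivAt
      (fun t => Real.cos (Real.pi * t) * u t - Real.sin (Real.pi * t) / Real.pi * w t) 0 t := by
    have hπ : HasDerivAt (fun t => Real.pi * t) Real.pi t := by
      simpa using (hasDerivAt_id t).const_mul Real.pi
    refine ((hπ.cos.mul (hu t)).sub ((hπ.sin.div_const Real.pi).mul (hw t))).congr_deriv ?_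
    field_simp
    ring
  simpa [neg_eq_iff_eq_neg] using is_const_of_hasDerivAt_zero h 1 0

theorem exists_forall_hasDerivAt_of_conserved {E G : Type*} [NormedAddCommGroup E] [NormedSpace ℝ E]
    [FiniteDimensional ℝ E] [NormedAddCommGroup G] [NormedSpace ℝ G] {v : E → E}
    (hv : ContDiff ℝ 1 v) {f : E → G} (hf : Differentiable ℝ f)
    (hfv : ∀ x, fderiv ℝ f x (v x) = 0) {x : E} {R : ℝ} (hR : ∀ y, f y = f x → ‖y‖ ≤ R) :
    ∃ γ : ℝ → E, γ 0 = x ∧ (∀ t, HasDerivAt γ (v (γ t)) t) ∧ ∀ t, f (γ t) = f x := by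
  have hR0 : 0 ≤ R := (norm_nonneg x).trans (hR x rfl)
  let χ : ContDiffBump (0 : E) := ⟨R + 1, R + 2, by linarith, by linarith⟩
  let w : E → E := fun z => χ z • v z
  have hw : ContDiff ℝ 1 w := χ.contDiff.smul hv
  have hwc : HasCompactSupport w := χ.hasCompactSupport.smul_right
  obtain ⟨K, hK⟩ := hw.lipschitzWith_of_hasCompactSupport hwc one_ne_zero
  obtain ⟨C, hC⟩ := hwc.exists_bound_of_continuous hw.continuous
  obtain ⟨γ, h0, hγ⟩ := exists_forall_hasDerivAt_of_lipschitzWith hK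
    (C := C.toNNReal) (fun z => (hC z).trans (Real.le_coe_toNNReal C)) x
  have hconst (t : ℝ) : f (γ t) = f x := by
    rw [← h0]
    refine is_const_of_hasDerivAt_zero (u := f ∘ γ) (fun s => ?_) t 0
    simpa [w, hfv] using (hf (γ s)).hasFDerivAt.comp_hasDerivAt s (hγ s)
  refine ⟨γ, h0, fun t => ?_, hconst⟩
  have h1 : χ (γ t) = 1 := χ.one_of_mem_closedBall <| by
    simpa using (hR _ (hconst t)).trans (le_add_of_nonneg_right zero_le_one)
  simpa [w, h1] using hγ t

/-! ### Hamiltonian flow lines in `ℝ³ × ℝ³` -/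

instance fact_finrank_E3 : Fact (Module.finrank ℝ (EuclideanSpace ℝ (Fin (2 + 1))) = 2 + 1) :=
  ⟨finrank_euclideanSpace_fin⟩

/-- The inclusion of `S² × S²` into `ℝ³ × ℝ³`. -/
def inclX (q : S2xS2) : E3 × E3 := (q.1, q.2)

theorem contMDiff_inclX : ContMDiff modelX 𝓘(ℝ, E3 × E3) ∞ inclX :=
  (contMDiff_coe_sphere.comp contMDiff_fst).prodMk_space (contMDiff_coe_sphere.comp contMDiff_snd)

theorem mdifferentiable_inclX : MDifferentiable modelX 𝓘(ℝ, E3 × E3) inclX :=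
  contMDiff_inclX.mdifferentiable (by simp)

theorem mvfderiv_comp_inclX {G : Type*} [NormedAddCommGroup G] [NormedSpace ℝ G]
    {F : E3 × E3 → G} {q : S2xS2} (hF : DifferentiableAt ℝ F (inclX q))
    (v : TangentSpace modelX q) :
    mvfderiv modelX (fun q => F (inclX q)) q v
      = fderiv ℝ F (inclX q) (mvfderiv modelX inclX q v) := by
  rw [← mfderiv_eq_fderiv]
  exact mfderiv_comp_apply (I' := 𝓘(ℝ, E3 × E3)) q hF.mdifferentiableAt
    (mdifferentiable_inclX q) v

theorem mdifferentiableAt_coe_S2 (p : S2) :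
    MDifferentiableAt (𝓡 2) 𝓘(ℝ, E3) (fun p : S2 => (p : E3)) p :=
  (contMDiff_coe_sphere (m := 1) p).mdifferentiableAt one_ne_zero

theorem mvfderiv_inclX_fst (q : S2xS2) (v : TangentSpace modelX q) :
    (mvfderiv modelX inclX q v).1 = mvfderiv (𝓡 2) (fun p : S2 => (p : E3)) q.1
      (mfderiv modelX (𝓡 2) Prod.fst q v) := by
  have h := mvfderiv_comp_inclX (q := q) (F := Prod.fst) differentiableAt_fst v
  rw [fderiv_fst] at h
  exact h.symm.trans
    (mfderiv_comp_apply (I' := 𝓡 2) q (mdifferentiableAt_coe_S2 q.1) mdifferentiableAt_fst v)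

theorem mvfderiv_inclX_snd (q : S2xS2) (v : TangentSpace modelX q) :
    (mvfderiv modelX inclX q v).2 = mvfderiv (𝓡 2) (fun p : S2 => (p : E3)) q.2
      (mfderiv modelX (𝓡 2) Prod.snd q v) := by
  have h := mvfderiv_comp_inclX (q := q) (F := Prod.snd) differentiableAt_snd v
  rw [fderiv_snd] at h
  exact h.symm.trans
    (mfderiv_comp_apply (I' := 𝓡 2) q (mdifferentiableAt_coe_S2 q.2) mdifferentiableAt_snd v)

theorem omega_eq_ambientAreaForm (α : ℝ) (q : S2xS2) (u v : TangentSpace modelX q) :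
    omega α q u v
      = 2 * (α + 1) * ambientAreaForm q.1
          (mvfderiv modelX inclX q u).1 (mvfderiv modelX inclX q v).1
        + 2 * α * ambientAreaForm q.2
          (mvfderiv modelX inclX q u).2 (mvfderiv modelX inclX q v).2 := by
  simp only [mvfderiv_inclX_fst, mvfderiv_inclX_snd]
  rfl

theorem inner_mvfderiv_coe (p : S2) (u : TangentSpace (𝓡 2) p) :
    inner ℝ (p : E3) (mvfderiv (𝓡 2) (fun p : S2 => (p : E3)) p u) = 0 := by
  have h : mvfderiv (𝓡 2) (fun p : S2 => (p : E3)) p u ∈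
      (mvfderiv (𝓡 2) ((↑) : S2 → E3) p).range := ⟨u, rfl⟩
  rw [range_mvfderiv_subtypeVal] at h
  exact Submodule.mem_orthogonal_singleton_iff_inner_right.1 h

theorem mdifferentiable_of_contDiff_inclX {c : ℝ → S2xS2}
    (hc : ContDiff ℝ 1 fun t => inclX (c t)) : MDifferentiable 𝓘(ℝ, ℝ) modelX c := by
  have h₁ : ContMDiff 𝓘(ℝ, ℝ) (𝓡 2) 1 fun t => (c t).1 :=
    ContMDiff.codRestrict_sphere hc.fst.contMDiff fun t => (c t).1.2
  have h₂ : ContMDiff 𝓘(ℝ, ℝ) (𝓡 2) 1 fun t => (c t).2 :=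
    ContMDiff.codRestrict_sphere hc.snd.contMDiff fun t => (c t).2.2
  exact (h₁.prodMk h₂).mdifferentiable one_ne_zero

theorem mvfderiv_inclX_mfderiv {c : ℝ → S2xS2} {t : ℝ} (hc : MDifferentiableAt 𝓘(ℝ, ℝ) modelX c t) :
    mvfderiv modelX inclX (c t) (mfderiv 𝓘(ℝ, ℝ) modelX c t (1 : ℝ))
      = deriv (fun s => inclX (c s)) t := by
  have h := mfderiv_comp_apply (I' := modelX) t (mdifferentiable_inclX (c t)) hc (1 : ℝ)
  refine h.symm.trans ?_
  rw [← fderiv_apply_one_eq_deriv, ← mfderiv_eq_fderiv]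
  rfl

/-- The cross product on `ℝ³`. -/
def cross (u v : E3) : E3 :=
  WithLp.toLp 2 (crossProduct (u : Fin 3 → ℝ) (v : Fin 3 → ℝ))

theorem inner_E3 (u v : E3) : inner ℝ u v = u 0 * v 0 + u 1 * v 1 + u 2 * v 2 := by
  simp [PiLp.inner_apply, Fin.sum_univ_three, mul_comm]

@[simp] theorem cross_apply_zero (u v : E3) : cross u v 0 = u 1 * v 2 - u 2 * v 1 := rfl

@[simp] theorem cross_apply_one (u v : E3) : cross u v 1 = u 2 * v 0 - u 0 * v 2 := rfl

@[simp] theorem cross_apply_two (u v : E3) : cross u v 2 = u 0 * v 1 - u 1 * v 0 := rfl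

theorem inner_cross_right_self (u v : E3) : inner ℝ v (cross u v) = 0 := by
  simp only [inner_E3, cross_apply_zero, cross_apply_one, cross_apply_two]
  ring

theorem contDiff_cross {E : Type*} [NormedAddCommGroup E] [NormedSpace ℝ E] {n : ℕ∞ω} {f g : E → E3}
    (hf : ContDiff ℝ n f) (hg : ContDiff ℝ n g) : ContDiff ℝ n fun x => cross (f x) (g x) := by
  have hf' := contDiff_euclidean.1 hf
  have hg' := contDiff_euclidean.1 hg
  refine contDiff_euclidean.2 fun i => ?_
  fin_cases i
  · exact ((hf' 1).mul (hg' 2)).sub ((hf' 2).mul (hg' 1))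
  · exact ((hf' 2).mul (hg' 0)).sub ((hf' 0).mul (hg' 2))
  · exact ((hf' 0).mul (hg' 1)).sub ((hf' 1).mul (hg' 0))

theorem ambientAreaForm_smul_cross {p a v : E3} (hp : ‖p‖ = 1) (hv : inner ℝ p v = 0) (c : ℝ) :
    ambientAreaForm p (c • cross a p) v = c * inner ℝ a v / (4 * Real.pi) := by
  have hp2 : inner ℝ p p = 1 := by simp [hp]
  rw [inner_E3] at hv hp2
  rw [ambientAreaForm, Matrix.det_fin_three, inner_E3]
  congr 1
  simp only [Matrix.of_apply, Matrix.cons_val, PiLp.smul_apply, smul_eq_mul, cross_apply_zero,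
    cross_apply_one, cross_apply_two]
  linear_combination c * (a 0 * v 0 + a 1 * v 1 + a 2 * v 2) * hp2
    - c * (a 0 * p 0 + a 1 * p 1 + a 2 * p 2) * hv

/-- `a` and `b` are the gradients of `F : ℝ³ × ℝ³ → ℝ` with respect to the two factors. -/
def HasPartialGradients (F : E3 × E3 → ℝ) (a b : E3 × E3 → E3) : Prop :=
  ∀ x, HasFDerivAt F ((innerSL ℝ (a x)).coprod (innerSL ℝ (b x))) x

/-- The Hamiltonian vector field on `X_α` of `F / (2π)`, extended to `ℝ³ × ℝ³`, in terms of the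
partial gradients `a` and `b` of `F`. -/
def hamiltonianField (α : ℝ) (a b : E3 × E3 → E3) (x : E3 × E3) : E3 × E3 :=
  ((α + 1)⁻¹ • cross (a x) x.1, α⁻¹ • cross (b x) x.2)

/-- A curve in `S² × S²` that integrates `hamiltonianField α a b`. -/
def IsFlowLine (α : ℝ) (a b : E3 × E3 → E3) (γ : ℝ → S2xS2) : Prop :=
  ∀ t, HasDerivAt (fun s => inclX (γ s)) (hamiltonianField α a b (inclX (γ t))) t

theorem HasPartialGradients.contDiff_hamiltonianField {F : E3 × E3 → ℝ} {a b : E3 × E3 → E3}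
    (h : HasPartialGradients F a b) (hF : ContDiff ℝ ∞ F) (α : ℝ) :
    ContDiff ℝ 1 (hamiltonianField α a b) := by
  have hdF : ContDiff ℝ 1 (fderiv ℝ F) := hF.fderiv_right (m := 1) (by norm_cast)
  have hdual {ι : E3 →L[ℝ] E3 × E3} {c : E3 × E3 → E3}
      (hc : ∀ x, fderiv ℝ F x ∘L ι = innerSL ℝ (c x)) : ContDiff ℝ 1 c := by
    have : c = fun x => (InnerProductSpace.toDual ℝ E3).symm (fderiv ℝ F x ∘L ι) :=
      funext fun x => ((LinearIsometryEquiv.symm_apply_eq _).2 (hc x)).symm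
    rw [this]
    exact (InnerProductSpace.toDual ℝ E3).symm.contDiff.comp (hdF.clm_comp contDiff_const)
  have ha : ContDiff ℝ 1 a := hdual (ι := .inl ℝ E3 E3) fun x => by
    rw [(h x).fderiv, ContinuousLinearMap.coprod_comp_inl]
  have hb : ContDiff ℝ 1 b := hdual (ι := .inr ℝ E3 E3) fun x => by
    rw [(h x).fderiv, ContinuousLinearMap.coprod_comp_inr]
  exact ((contDiff_cross ha contDiff_fst).const_smul _).prodMk
    ((contDiff_cross hb contDiff_snd).const_smul _)

theorem IsFlowLine.contDiff {α : ℝ} {a b : E3 × E3 → E3} {γ : ℝ → S2xS2}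
    (hv : ContDiff ℝ 1 (hamiltonianField α a b)) (hγ : IsFlowLine α a b γ) :
    ContDiff ℝ 1 fun t => inclX (γ t) := by
  have hd : Differentiable ℝ fun t => inclX (γ t) := fun t => (hγ t).differentiableAt
  refine contDiff_one_iff_deriv.2 ⟨hd, ?_⟩
  rw [funext fun t => (hγ t).deriv]
  exact hv.continuous.comp hd.continuous

theorem isHamiltonianFlow_of_isFlowLine {α : ℝ} (hα : 0 < α) {F : E3 × E3 → ℝ}
    {a b : E3 × E3 → E3} (hF : ContDiff ℝ ∞ F) (hFab : HasPartialGradients F a b)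
    {φ : ℝ → S2xS2 → S2xS2} (h0 : ∀ p, φ 0 p = p) (hφ : ∀ p, IsFlowLine α a b fun t => φ t p) :
    IsHamiltonianFlow α (fun z => F (inclX z.2) / (2 * Real.pi)) φ := by
  have hd (p : S2xS2) : MDifferentiable 𝓘(ℝ, ℝ) modelX fun t => φ t p :=
    mdifferentiable_of_contDiff_inclX ((hφ p).contDiff (hFab.contDiff_hamiltonianField hF α))
  refine ⟨?_, h0, hd, fun t p v => ?_⟩
  · exact (hF.div_const _).contMDiff.comp (contMDiff_inclX.comp contMDiff_snd)
  have hdF : mvfderiv modelX (fun q => F (inclX q) / (2 * Real.pi)) (φ t p) v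
      = (inner ℝ (a (inclX (φ t p))) (mvfderiv modelX inclX (φ t p) v).1
          + inner ℝ (b (inclX (φ t p))) (mvfderiv modelX inclX (φ t p) v).2) / (2 * Real.pi) := by
    have h := (hFab (inclX (φ t p))).mul_const (2 * Real.pi)⁻¹
    simp only [div_eq_mul_inv]
    rw [mvfderiv_comp_inclX (F := fun x => F x * (2 * Real.pi)⁻¹) h.differentiableAt v, h.fderiv]
    simp [mul_comm]
  have h₁ : ambientAreaForm (φ t p).1 ((α + 1)⁻¹ • cross (a (inclX (φ t p))) (φ t p).1)
      (mvfderiv modelX inclX (φ t p) v).1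
      = (α + 1)⁻¹ * inner ℝ (a (inclX (φ t p))) (mvfderiv modelX inclX (φ t p) v).1
        / (4 * Real.pi) :=
    ambientAreaForm_smul_cross (by simp)
      (by rw [mvfderiv_inclX_fst]; exact inner_mvfderiv_coe _ _) _
  have h₂ : ambientAreaForm (φ t p).2 (α⁻¹ • cross (b (inclX (φ t p))) (φ t p).2)
      (mvfderiv modelX inclX (φ t p) v).2
      = α⁻¹ * inner ℝ (b (inclX (φ t p))) (mvfderiv modelX inclX (φ t p) v).2
        / (4 * Real.pi) :=
    ambientAreaForm_smul_cross (by simp)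
      (by rw [mvfderiv_inclX_snd]; exact inner_mvfderiv_coe _ _) _
  refine Eq.trans ?_ hdF.symm
  rw [omega_eq_ambientAreaForm, mvfderiv_inclX_mfderiv (hd p t), (hφ p t).deriv]
  refine (congrArg₂ (fun r s => 2 * (α + 1) * r + 2 * α * s) h₁ h₂).trans ?_
  have := hα.ne'
  have := (add_pos hα one_pos).ne'
  field_simp
  ring

theorem norm_inclX (q : S2xS2) : ‖inclX q‖ = 1 := by
  simp [inclX]

theorem exists_isFlowLine {α : ℝ} {a b : E3 × E3 → E3}
    (hv : ContDiff ℝ 1 (hamiltonianField α a b)) (q : S2xS2) :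
    ∃ γ : ℝ → S2xS2, γ 0 = q ∧ IsFlowLine α a b γ := by
  let f : E3 × E3 → ℝ × ℝ := fun x => (‖x.1‖ ^ 2, ‖x.2‖ ^ 2)
  have hf : Differentiable ℝ f :=
    (differentiable_fst.norm_sq ℝ).prodMk (differentiable_snd.norm_sq ℝ)
  have hfv (x) : fderiv ℝ f x (hamiltonianField α a b x) = 0 := by
    have h : HasFDerivAt f _ x := (hasFDerivAt_fst.norm_sq).prodMk (hasFDerivAt_snd.norm_sq)
    rw [h.fderiv]
    simp [hamiltonianField, inner_cross_right_self]
  have hfq : f (inclX q) = (1, 1) := by simp [f, inclX]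
  have mem_sphere {x : E3 × E3} (hx : f x = (1, 1)) : ‖x.1‖ = 1 ∧ ‖x.2‖ = 1 := by
    simpa [f, pow_eq_one_iff_of_nonneg] using hx
  obtain ⟨γ, h0, hγ, hconst⟩ := exists_forall_hasDerivAt_of_conserved hv hf hfv (x := inclX q)
    (R := 1) fun x hx => by
      obtain ⟨h1, h2⟩ := mem_sphere (hx.trans hfq)
      exact max_le h1.le h2.le
  have hS (t : ℝ) := mem_sphere ((hconst t).trans hfq)
  refine ⟨fun t => (⟨(γ t).1, mem_sphere_zero_iff_norm.2 (hS t).1⟩,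
    ⟨(γ t).2, mem_sphere_zero_iff_norm.2 (hS t).2⟩), ?_, hγ⟩
  refine Prod.ext (Subtype.ext ?_) (Subtype.ext ?_) <;> simp [h0, inclX]

theorem IsFlowLine.comp_add_const {α : ℝ} {a b : E3 × E3 → E3} {γ : ℝ → S2xS2}
    (hγ : IsFlowLine α a b γ) (s : ℝ) : IsFlowLine α a b fun t => γ (t + s) :=
  fun t => (hγ (t + s)).comp_add_const t s

theorem inclX_injective : Function.Injective inclX := fun _ _ h =>
  Prod.ext (Subtype.ext (congrArg Prod.fst h)) (Subtype.ext (congrArg Prod.snd h))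

theorem IsFlowLine.eq_of_eq {α : ℝ} {a b : E3 × E3 → E3}
    (hv : ContDiff ℝ 1 (hamiltonianField α a b)) {γ δ : ℝ → S2xS2} (hγ : IsFlowLine α a b γ)
    (hδ : IsFlowLine α a b δ) {t₀ : ℝ} (h : γ t₀ = δ t₀) : γ = δ := by
  obtain ⟨K, hK⟩ := hv.contDiffOn.exists_lipschitzOnWith one_ne_zero
    (convex_closedBall (0 : E3 × E3) 1) (isCompact_closedBall 0 1)
  have mem_ball (q : S2xS2) : inclX q ∈ closedBall (0 : E3 × E3) 1 := by
    simp [norm_inclX]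
  have := ODE_solution_unique_univ (v := fun _ => hamiltonianField α a b)
    (s := fun _ => closedBall 0 1) (fun _ => hK)
    (fun t => ⟨hγ t, mem_ball _⟩) (fun t => ⟨hδ t, mem_ball _⟩) (congrArg inclX h)
  exact funext fun t => inclX_injective (congrFun this t)

/-- Flow lines can be prolonged and restarted, so the time-one map sends `L` onto `L'`. -/
theorem hamIsotopic_of_isFlowLine {α : ℝ} (hα : 0 < α) {F : E3 × E3 → ℝ} {a b : E3 × E3 → E3}
    (hF : ContDiff ℝ ∞ F) (hFab : HasPartialGradients F a b) {L L' : Set S2xS2}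
    (h : ∀ γ, IsFlowLine α a b γ → (γ 0 ∈ L ↔ γ 1 ∈ L')) : HamIsotopic α L L' := by
  have hv := hFab.contDiff_hamiltonianField hF α
  choose φ h0 hφ using exists_isFlowLine hv
  refine ⟨_, fun t p => φ p t, isHamiltonianFlow_of_isFlowLine hα hF hFab h0 hφ,
    Subset.antisymm ?_ fun q hq => ?_⟩
  · rintro _ ⟨p, hp, rfl⟩
    exact (h _ (hφ p)).1 (by rwa [h0])
  · have hback := (hφ q).comp_add_const (-1)
    have : φ (φ q (-1)) = fun t => φ q (t + -1) :=
      (hφ _).eq_of_eq hv hback (t₀ := 0) (by simp [h0])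
    refine ⟨φ q (-1), ?_, by simp [this, h0]⟩
    simpa [h0] using (h _ hback).2 (by simpa [h0] using hq)

/-! ### Concatenation of Hamiltonian isotopies -/

theorem omega_smul_left (α : ℝ) (q : S2xS2) (c : ℝ) (u v : TangentSpace modelX q) :
    omega α q (c • u) v = c * omega α q u v := by
  have hu : mvfderiv modelX inclX q (c • u) = c • mvfderiv modelX inclX q u := map_smul _ _ _
  have harea (p u v : E3) : ambientAreaForm p (c • u) v = c * ambientAreaForm p u v := by
    simp only [ambientAreaForm, Matrix.det_fin_three, Matrix.of_apply, Matrix.cons_val,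
      PiLp.smul_apply, smul_eq_mul]
    ring
  rw [omega_eq_ambientAreaForm, omega_eq_ambientAreaForm, hu, Prod.smul_fst, Prod.smul_snd, harea,
    harea]
  ring

theorem HamIsotopic.refl (α : ℝ) (L : Set S2xS2) : HamIsotopic α L L := by
  refine ⟨fun _ => 0, fun _ p => p, ⟨contMDiff_const, fun _ => rfl,
    fun _ => mdifferentiable_const, fun t p v => ?_⟩, image_id' L⟩
  have hzero : omega α p (0 : TangentSpace modelX p) v = 0 := by
    simpa using omega_smul_left α p 0 0 v
  rw [mfderiv_const]
  simp only [mvfderiv_const]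
  exact hzero

theorem IsHamiltonianFlow.reparam {α : ℝ} {H : ℝ × S2xS2 → ℝ} {φ : ℝ → S2xS2 → S2xS2}
    (h : IsHamiltonianFlow α H φ) {ρ : ℝ → ℝ} (hρ : ContDiff ℝ ∞ ρ) (h0 : ρ 0 = 0) :
    IsHamiltonianFlow α (fun z => deriv ρ z.1 * H (ρ z.1, z.2)) (fun t => φ (ρ t)) := by
  have hρm (t : ℝ) : MDifferentiableAt 𝓘(ℝ, ℝ) 𝓘(ℝ, ℝ) ρ t :=
    (hρ.differentiable (by simp) t).mdifferentiableAt
  have smooth_fst {f : ℝ → ℝ} (hf : ContDiff ℝ ∞ f) :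
      ContMDiff (𝓘(ℝ, ℝ).prod modelX) 𝓘(ℝ, ℝ) ∞ fun z : ℝ × S2xS2 => f z.1 :=
    hf.contMDiff.comp contMDiff_fst
  refine ⟨?_, fun p => by rw [h0, h.zero], fun p => (h.differentiable p).comp hρm,
    fun t p v => ?_⟩
  · exact (smooth_fst (contDiff_infty_iff_deriv.1 hρ).2).mul
      (h.smooth.comp ((smooth_fst hρ).prodMk contMDiff_snd))
  have hvel : mfderiv 𝓘(ℝ, ℝ) modelX (fun s => φ (ρ s) p) t (1 : ℝ)
      = deriv ρ t • mfderiv 𝓘(ℝ, ℝ) modelX (fun s => φ s p) (ρ t) (1 : ℝ) := by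
    refine (mfderiv_comp_apply (I' := 𝓘(ℝ, ℝ)) t (h.differentiable p (ρ t)) (hρm t)
      (1 : ℝ)).trans ?_
    have hone : mfderiv 𝓘(ℝ, ℝ) 𝓘(ℝ, ℝ) ρ t (1 : ℝ) = deriv ρ t • (1 : ℝ) := by
      rw [mfderiv_eq_fderiv]
      exact (fderiv_apply_one_eq_deriv (𝕜 := ℝ) (f := ρ)).trans (mul_one (deriv ρ t)).symm
    rw [hone]
    exact (mfderiv 𝓘(ℝ, ℝ) modelX (fun s => φ s p) (ρ t)).map_smul _ _
  have hH : MDifferentiableAt modelX 𝓘(ℝ, ℝ) (fun q => H (ρ t, q)) (φ (ρ t) p) :=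
    (h.smooth.comp (contMDiff_const.prodMk contMDiff_id)).mdifferentiable (by simp) _
  rw [hvel, omega_smul_left, h.equation]
  exact (congrArg (fun T => T v) (const_smul_mfderiv hH (deriv ρ t))).symm

/-- At every time one of the two flows is at rest, so `H` need not be transported by `ψ`. -/
theorem IsHamiltonianFlow.comp_of_separated {α : ℝ} {H K : ℝ × S2xS2 → ℝ}
    {φ ψ : ℝ → S2xS2 → S2xS2} (hφ : IsHamiltonianFlow α H φ) (hψ : IsHamiltonianFlow α K ψ)
    (hsep : ∀ t, ((∀ᶠ s in 𝓝 t, φ s = φ t) ∧ ∀ q, H (t, q) = 0) ∨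
      ((∀ᶠ s in 𝓝 t, ψ s = id) ∧ ∀ q, K (t, q) = 0)) :
    IsHamiltonianFlow α (fun z => H z + K z) (fun t => ψ t ∘ φ t) := by
  have key (t : ℝ) (p : S2xS2) :
      MDifferentiableAt 𝓘(ℝ, ℝ) modelX (fun s => ψ s (φ s p)) t ∧
      ∀ v : TangentSpace modelX (ψ t (φ t p)), omega α (ψ t (φ t p))
          (mfderiv 𝓘(ℝ, ℝ) modelX (fun s => ψ s (φ s p)) t (1 : ℝ)) v
        = mvfderiv modelX (fun q => H (t, q) + K (t, q)) (ψ t (φ t p)) v := by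
    rcases hsep t with ⟨hconst, hH⟩ | ⟨hid, hK⟩
    · have hev : (fun s => ψ s (φ s p)) =ᶠ[𝓝 t] fun s => ψ s (φ t p) :=
        hconst.mono fun s hs => by simp only [hs]
      refine ⟨(hψ.differentiable _ t).congr_of_eventuallyEq hev, ?_⟩
      simp only [hH, zero_add]
      rw [hev.mfderiv_eq]
      exact hψ.equation t (φ t p)
    · have hev : (fun s => ψ s (φ s p)) =ᶠ[𝓝 t] fun s => φ s p :=
        hid.mono fun s hs => by simp only [hs, id_eq]
      refine ⟨(hφ.differentiable _ t).congr_of_eventuallyEq hev, ?_⟩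
      simp only [hK, add_zero]
      have hpt : ψ t (φ t p) = φ t p := hev.eq_of_nhds
      rw [hev.mfderiv_eq, hpt]
      exact hφ.equation t p
  exact ⟨hφ.smooth.add hψ.smooth, fun p => by simp [hφ.zero, hψ.zero], fun p t => (key t p).1,
    fun t p => (key t p).2⟩

theorem HamIsotopic.trans {α : ℝ} {L₁ L₂ L₃ : Set S2xS2} (h₁ : HamIsotopic α L₁ L₂)
    (h₂ : HamIsotopic α L₂ L₃) : HamIsotopic α L₁ L₃ := by
  obtain ⟨H, φ, hφ, rfl⟩ := h₁
  obtain ⟨K, ψ, hψ, rfl⟩ := h₂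
  let σ : ℝ → ℝ := fun t => Real.smoothTransition (3 * t)
  let τ : ℝ → ℝ := fun t => Real.smoothTransition (3 * t - 2)
  have hσ : ContDiff ℝ ∞ σ := Real.smoothTransition.contDiff.comp (by fun_prop)
  have hτ : ContDiff ℝ ∞ τ := Real.smoothTransition.contDiff.comp (by fun_prop)
  have hσ1 {t : ℝ} (ht : 1 / 3 ≤ t) : σ t = 1 :=
    Real.smoothTransition.one_of_one_le (by linarith)
  have hτ0 {t : ℝ} (ht : t ≤ 2 / 3) : τ t = 0 :=
    Real.smoothTransition.zero_of_nonpos (by linarith)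
  have hσ0 : σ 0 = 0 := Real.smoothTransition.zero_of_nonpos (by norm_num)
  have hτ1 : τ 1 = 1 := Real.smoothTransition.one_of_one_le (by norm_num)
  refine ⟨_, _, (hφ.reparam hσ hσ0).comp_of_separated (hψ.reparam hτ (hτ0 (by norm_num)))
    fun t => ?_, ?_⟩
  · rcases lt_or_ge t (2 / 3) with ht | ht
    · have hev : τ =ᶠ[𝓝 t] fun _ => 0 := (eventually_lt_nhds ht).mono fun s hs => hτ0 hs.le
      exact .inr ⟨hev.mono fun s hs => funext fun q => by simp only [hs, hψ.zero, id_eq],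
        fun q => by simp [hev.deriv_eq]⟩
    · have hev : σ =ᶠ[𝓝 t] fun _ => 1 :=
        (eventually_gt_nhds (show 1 / 3 < t by linarith)).mono fun s hs => hσ1 hs.le
      exact .inl ⟨hev.mono fun s hs => by simp only [hs, hev.eq_of_nhds],
        fun q => by simp [hev.deriv_eq]⟩
  · simp only [hσ1 (show 1 / 3 ≤ (1 : ℝ) by norm_num), hτ1, image_comp]

/-! ### Split tori as fibres of the action map -/

/-- The map `(z₁, z₂) ↦ ((α + 1) z₁, α z₂)` of the heights, whose fibres are the split tori. -/
def actionMap (α : ℝ) (q : S2xS2) : ℝ × ℝ :=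
  ((α + 1) * (q.1 : E3) 2, α * (q.2 : E3) 2)

theorem continuous_actionMap (α : ℝ) : Continuous (actionMap α) := by
  unfold actionMap
  fun_prop

theorem splitTorus_eq_preimage {α : ℝ} (hα : 0 < α) (x y : ℝ) :
    splitTorus α x y = actionMap α ⁻¹' {(x, y)} := by
  ext q
  rw [splitTorus, mem_prod, mem_heightCircle_iff (by positivity),
    mem_heightCircle_iff (by positivity), mul_div_mul_left _ _ two_ne_zero,
    mul_div_mul_left _ _ two_ne_zero, eq_div_iff (by positivity), eq_div_iff hα.ne',
    mul_comm _ (α + 1), mul_comm _ α]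
  exact Prod.mk_inj.symm

theorem mem_splitTorus_iff {α : ℝ} (hα : 0 < α) {x y : ℝ} {q : S2xS2} :
    q ∈ splitTorus α x y ↔ (α + 1) * (q.1 : E3) 2 = x ∧ α * (q.2 : E3) 2 = y := by
  rw [splitTorus_eq_preimage hα]
  exact Prod.mk_inj

theorem exists_mem_S2_height_eq {z : ℝ} (hz : z ∈ Icc (-1) 1) : ∃ p : S2, (p : E3) 2 = z := by
  have h : 0 ≤ 1 - z ^ 2 := by nlinarith [hz.1, hz.2]
  refine ⟨⟨cylPoint 0 z, ?_⟩, by simp [cylPoint]⟩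
  rw [mem_sphere_zero_iff_norm, EuclideanSpace.norm_eq]
  simp [cylPoint, Fin.sum_univ_three, Real.sq_sqrt h]

theorem splitTorus_nonempty {α x y : ℝ} (hα : 0 < α) (hx : |x| ≤ α + 1) (hy : |y| ≤ α) :
    (splitTorus α x y).Nonempty := by
  have height_mem {z c : ℝ} (hc : 0 < c) (h : |z| ≤ c) : z / c ∈ Icc (-1) 1 :=
    abs_le.1 (by rwa [abs_div, abs_of_pos hc, div_le_one hc])
  obtain ⟨p, hp⟩ := exists_mem_S2_height_eq (height_mem (add_pos hα one_pos) hx)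
  obtain ⟨q, hq⟩ := exists_mem_S2_height_eq (height_mem hα hy)
  exact ⟨(p, q), (mem_splitTorus_iff hα).2 ⟨by rw [hp]; field_simp, by rw [hq]; field_simp⟩⟩

theorem disjoint_splitTorus {α x x' : ℝ} (hα : 0 < α) (h : x ≠ x') (y y' : ℝ) :
    Disjoint (splitTorus α x y) (splitTorus α x' y') :=
  disjoint_left.2 fun _ hq hq' =>
    h (((mem_splitTorus_iff hα).1 hq).1.symm.trans ((mem_splitTorus_iff hα).1 hq').1)

theorem isOpen_setOf_splitTorus_subset {α : ℝ} (hα : 0 < α) {W : Set S2xS2} (hW : IsOpen W) :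
    IsOpen {z : ℝ × ℝ | splitTorus α z.1 z.2 ⊆ W} := by
  have : {z : ℝ × ℝ | splitTorus α z.1 z.2 ⊆ W} = kernImage (actionMap α) W := by
    ext z
    rw [mem_ofPred_eq, splitTorus_eq_preimage hα]
    rfl
  rw [this]
  exact isClosedMap_iff_kernImage.1 (continuous_actionMap α).isClosedMap hW

theorem IsFlowLine.hasDerivAt_fst_apply {α : ℝ} {a b : E3 × E3 → E3} {γ : ℝ → S2xS2}
    (hγ : IsFlowLine α a b γ) (i : Fin 3) (t : ℝ) :
    HasDerivAt (fun s => ((γ s).1 : E3) i)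
      ((α + 1)⁻¹ * cross (a (inclX (γ t))) (γ t).1 i) t :=
  ((PiLp.proj 2 (fun _ : Fin 3 => ℝ) i : E3 →L[ℝ] ℝ) ∘L
    ContinuousLinearMap.fst ℝ E3 E3).hasFDerivAt.comp_hasDerivAt t (hγ t)

theorem IsFlowLine.hasDerivAt_snd_apply {α : ℝ} {a b : E3 × E3 → E3} {γ : ℝ → S2xS2}
    (hγ : IsFlowLine α a b γ) (i : Fin 3) (t : ℝ) :
    HasDerivAt (fun s => ((γ s).2 : E3) i)
      (α⁻¹ * cross (b (inclX (γ t))) (γ t).2 i) t :=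
  ((PiLp.proj 2 (fun _ : Fin 3 => ℝ) i : E3 →L[ℝ] ℝ) ∘L
    ContinuousLinearMap.snd ℝ E3 E3).hasFDerivAt.comp_hasDerivAt t (hγ t)

theorem cross_single_zero_apply_one (r : ℝ) (p : E3) :
    cross (EuclideanSpace.single 0 r) p 1 = -(r * p 2) := by
  simp

theorem cross_single_zero_apply_two (r : ℝ) (p : E3) :
    cross (EuclideanSpace.single 0 r) p 2 = r * p 1 := by
  simp

theorem hasPartialGradients_tilt (r s : ℝ) :
    HasPartialGradients (fun x => r * x.1 0 + s * x.2 0) (fun _ => EuclideanSpace.single 0 r)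
      (fun _ => EuclideanSpace.single 0 s) := by
  intro x
  have h₁ := (PiLp.hasFDerivAt_apply (𝕜 := ℝ) 2 x.1 0).comp x (hasFDerivAt_fst (p := x))
  have h₂ := (PiLp.hasFDerivAt_apply (𝕜 := ℝ) 2 x.2 0).comp x (hasFDerivAt_snd (p := x))
  refine ((h₁.const_mul r).add (h₂.const_mul s)).congr_fderiv ?_
  ext v <;> simp [inner_E3]

theorem hamIsotopic_of_tilt {α : ℝ} (hα : 0 < α) (r s : ℝ) {L L' : Set S2xS2}
    (h : ∀ γ : ℝ → S2xS2,
      (∀ t, HasDerivAt (fun t => ((γ t).1 : E3) 2) (r * ((γ t).1 : E3) 1) t ∧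
        HasDerivAt (fun t => ((γ t).1 : E3) 1) (-r * ((γ t).1 : E3) 2) t ∧
        HasDerivAt (fun t => ((γ t).2 : E3) 2) (s * ((γ t).2 : E3) 1) t ∧
        HasDerivAt (fun t => ((γ t).2 : E3) 1) (-s * ((γ t).2 : E3) 2) t) →
      (γ 0 ∈ L ↔ γ 1 ∈ L')) : HamIsotopic α L L' := by
  have hα1 : α + 1 ≠ 0 := by positivity
  refine hamIsotopic_of_isFlowLine hα ?_
    (hasPartialGradients_tilt ((α + 1) * r) (α * s)) fun γ hγ => h γ fun t => ⟨?_, ?_, ?_, ?_⟩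
  · exact (contDiff_const.mul (contDiff_euclidean.1 contDiff_fst 0)).add
      (contDiff_const.mul (contDiff_euclidean.1 contDiff_snd 0))
  · refine (hγ.hasDerivAt_fst_apply 2 t).congr_deriv ?_
    rw [cross_single_zero_apply_two]
    field_simp
  · refine (hγ.hasDerivAt_fst_apply 1 t).congr_deriv ?_
    rw [cross_single_zero_apply_one]
    field_simp
  · refine (hγ.hasDerivAt_snd_apply 2 t).congr_deriv ?_
    rw [cross_single_zero_apply_two]
    field_simp
  · refine (hγ.hasDerivAt_snd_apply 1 t).congr_deriv ?_
    rw [cross_single_zero_apply_one]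
    field_simp

theorem hamIsotopic_neg_left {α : ℝ} (hα : 0 < α) (x y : ℝ) :
    HamIsotopic α (splitTorus α x y) (splitTorus α (-x) y) := by
  refine hamIsotopic_of_tilt hα Real.pi 0 fun γ hγ => ?_
  have h₁ : ((γ 1).1 : E3) 2 = -((γ 0).1 : E3) 2 :=
    apply_one_eq_neg_of_oscillator (fun t => (hγ t).1)
      fun t => ((hγ t).2.1.const_mul Real.pi).congr_deriv (by ring)
  have h₂ : ((γ 1).2 : E3) 2 = ((γ 0).2 : E3) 2 :=
    is_const_of_hasDerivAt_zero (fun t => (hγ t).2.2.1.congr_deriv (zero_mul _)) 1 0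
  rw [mem_splitTorus_iff hα, mem_splitTorus_iff hα, h₁, h₂, mul_neg, neg_inj]

theorem hamIsotopic_neg_right {α : ℝ} (hα : 0 < α) (x y : ℝ) :
    HamIsotopic α (splitTorus α x y) (splitTorus α x (-y)) := by
  refine hamIsotopic_of_tilt hα 0 Real.pi fun γ hγ => ?_
  have h₁ : ((γ 1).1 : E3) 2 = ((γ 0).1 : E3) 2 :=
    is_const_of_hasDerivAt_zero (fun t => (hγ t).1.congr_deriv (zero_mul _)) 1 0
  have h₂ : ((γ 1).2 : E3) 2 = -((γ 0).2 : E3) 2 :=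
    apply_one_eq_neg_of_oscillator (fun t => (hγ t).2.2.1)
      fun t => ((hγ t).2.2.2.const_mul Real.pi).congr_deriv (by ring)
  rw [mem_splitTorus_iff hα, mem_splitTorus_iff hα, h₁, h₂, mul_neg, neg_inj]

/-! ### Symmetric probes -/

/-- The Hamiltonian `f(z₁) g(z₂) Re (ζ₁ ζ₂)`, where `(ζ, z) ∈ ℂ × ℝ` are the coordinates of a point
of the sphere. Its flow moves the heights along the direction in which `(α + 1) z₁ - α z₂` is
constant. -/
def probeHamiltonian (f g : ℝ → ℝ) (x : E3 × E3) : ℝ :=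
  f (x.1 2) * g (x.2 2) * (x.1 0 * x.2 0 - x.1 1 * x.2 1)

/-- The gradient of `probeHamiltonian f g` with respect to the first factor. -/
def probeGradient (f g : ℝ → ℝ) (x : E3 × E3) : E3 :=
  !₂[f (x.1 2) * g (x.2 2) * x.2 0, -(f (x.1 2) * g (x.2 2) * x.2 1),
    deriv f (x.1 2) * g (x.2 2) * (x.1 0 * x.2 0 - x.1 1 * x.2 1)]

@[simp] theorem probeGradient_apply_zero (f g : ℝ → ℝ) (x : E3 × E3) :
    probeGradient f g x 0 = f (x.1 2) * g (x.2 2) * x.2 0 := rfl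

@[simp] theorem probeGradient_apply_one (f g : ℝ → ℝ) (x : E3 × E3) :
    probeGradient f g x 1 = -(f (x.1 2) * g (x.2 2) * x.2 1) := rfl

@[simp] theorem probeGradient_apply_two (f g : ℝ → ℝ) (x : E3 × E3) :
    probeGradient f g x 2
      = deriv f (x.1 2) * g (x.2 2) * (x.1 0 * x.2 0 - x.1 1 * x.2 1) := rfl

theorem hasPartialGradients_probeHamiltonian {f g : ℝ → ℝ} (hf : Differentiable ℝ f)
    (hg : Differentiable ℝ g) :
    HasPartialGradients (probeHamiltonian f g) (probeGradient f g)
      (fun x => probeGradient g f x.swap) := by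
  intro x
  have h₁ (i : Fin 3) := (PiLp.hasFDerivAt_apply (𝕜 := ℝ) 2 x.1 i).comp x (hasFDerivAt_fst (p := x))
  have h₂ (i : Fin 3) := (PiLp.hasFDerivAt_apply (𝕜 := ℝ) 2 x.2 i).comp x (hasFDerivAt_snd (p := x))
  have hf' := (hf (x.1 2)).hasDerivAt.comp_hasFDerivAt x (h₁ 2)
  have hg' := (hg (x.2 2)).hasDerivAt.comp_hasFDerivAt x (h₂ 2)
  have hR := ((h₁ 0).mul (h₂ 0)).sub ((h₁ 1).mul (h₂ 1))
  refine ((hf'.mul hg').mul hR).congr_fderiv ?_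
  ext v <;> simp [inner_E3] <;> ring

theorem contDiff_probeHamiltonian {f g : ℝ → ℝ} (hf : ContDiff ℝ ∞ f) (hg : ContDiff ℝ ∞ g) :
    ContDiff ℝ ∞ (probeHamiltonian f g) := by
  have h₁ : ∀ i, ContDiff ℝ ∞ fun x : E3 × E3 => x.1 i := contDiff_euclidean.1 contDiff_fst
  have h₂ : ∀ i, ContDiff ℝ ∞ fun x : E3 × E3 => x.2 i := contDiff_euclidean.1 contDiff_snd
  exact ((hf.comp (h₁ 2)).mul (hg.comp (h₂ 2))).mul
    (((h₁ 0).mul (h₂ 0)).sub ((h₁ 1).mul (h₂ 1)))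

theorem sq_add_sq_add_sq_S2 (p : S2) : (p : E3) 0 ^ 2 + (p : E3) 1 ^ 2 + (p : E3) 2 ^ 2 = 1 := by
  have h : ‖(p : E3)‖ ^ 2 = 1 := by simp
  rwa [EuclideanSpace.real_norm_sq_eq, Fin.sum_univ_three] at h

/-- The function `f(z)² (1 - z²)`, which governs the speed of the flow of a probe Hamiltonian. -/
def profile (f : ℝ → ℝ) (z : ℝ) : ℝ := f z ^ 2 * (1 - z ^ 2)

theorem hasDerivAt_profile {f : ℝ → ℝ} (hf : Differentiable ℝ f) (z : ℝ) :
    HasDerivAt (profile f) (2 * f z * deriv f z * (1 - z ^ 2) - 2 * z * f z ^ 2) z := by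
  refine (((hf z).hasDerivAt.pow 2).mul ((hasDerivAt_pow 2 z).const_sub 1)).congr_deriv ?_
  simp only [Nat.cast_ofNat, Nat.add_one_sub_one, pow_one, Pi.pow_apply]
  ring

/-- The function `f(z₁) g(z₂) Im (ζ₁ ζ₂)`, the velocity of `(α + 1) z₁` and of `α z₂` under the flow
of `probeHamiltonian f g`. -/
def probeVelocity (f g : ℝ → ℝ) (x : E3 × E3) : ℝ :=
  f (x.1 2) * g (x.2 2) * (x.1 0 * x.2 1 + x.1 1 * x.2 0)

/-- A flow line in `X_α` of `probeHamiltonian f g`. -/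
abbrev IsProbeFlowLine (α : ℝ) (f g : ℝ → ℝ) (γ : ℝ → S2xS2) : Prop :=
  IsFlowLine α (probeGradient f g) (fun x => probeGradient g f x.swap) γ

theorem IsProbeFlowLine.hasDerivAt_fst {α : ℝ} {f g : ℝ → ℝ} {γ : ℝ → S2xS2}
    (hγ : IsProbeFlowLine α f g γ) (hα : α + 1 ≠ 0) (t : ℝ) :
    HasDerivAt (fun t => (α + 1) * ((γ t).1 : E3) 2) (probeVelocity f g (inclX (γ t))) t := by
  refine ((hγ.hasDerivAt_fst_apply 2 t).const_mul (α + 1)).congr_deriv ?_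
  rw [mul_inv_cancel_left₀ hα]
  simp only [probeVelocity, inclX, cross_apply_two, probeGradient_apply_zero,
    probeGradient_apply_one]
  ring

theorem IsProbeFlowLine.hasDerivAt_snd {α : ℝ} {f g : ℝ → ℝ} {γ : ℝ → S2xS2}
    (hγ : IsProbeFlowLine α f g γ) (hα : α ≠ 0) (t : ℝ) :
    HasDerivAt (fun t => α * ((γ t).2 : E3) 2) (probeVelocity f g (inclX (γ t))) t := by
  refine ((hγ.hasDerivAt_snd_apply 2 t).const_mul α).congr_deriv ?_
  rw [mul_inv_cancel_left₀ hα]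
  simp only [probeVelocity, inclX, Prod.swap, cross_apply_two, probeGradient_apply_zero,
    probeGradient_apply_one]
  ring

theorem IsProbeFlowLine.hasDerivAt_probeVelocity {α : ℝ} {f g : ℝ → ℝ} {γ : ℝ → S2xS2}
    (hγ : IsProbeFlowLine α f g γ) (hf : Differentiable ℝ f) (hg : Differentiable ℝ g) (t : ℝ) :
    HasDerivAt (fun t => probeVelocity f g (inclX (γ t)))
      ((deriv (profile f) (((γ t).1 : E3) 2) * profile g (((γ t).2 : E3) 2) / (α + 1)
        + profile f (((γ t).1 : E3) 2) * deriv (profile g) (((γ t).2 : E3) 2) / α) / 2) t := by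
  have h₁ (i : Fin 3) := hγ.hasDerivAt_fst_apply i t
  have h₂ (i : Fin 3) := hγ.hasDerivAt_snd_apply i t
  have hf' := (hf (((γ t).1 : E3) 2)).hasDerivAt.comp t (h₁ 2)
  have hg' := (hg (((γ t).2 : E3) 2)).hasDerivAt.comp t (h₂ 2)
  refine ((hf'.mul hg').mul (((h₁ 0).mul (h₂ 1)).add ((h₁ 1).mul (h₂ 0)))).congr_deriv ?_
  rw [(hasDerivAt_profile hf _).deriv, (hasDerivAt_profile hg _).deriv]
  have e₁ := sq_add_sq_add_sq_S2 (γ t).1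
  have e₂ := sq_add_sq_add_sq_S2 (γ t).2
  simp only [profile, inclX, Prod.swap, cross_apply_zero, cross_apply_one, cross_apply_two,
    probeGradient_apply_zero, probeGradient_apply_one, probeGradient_apply_two, Pi.add_apply,
    Pi.mul_apply, Function.comp_apply]
  generalize ((γ t).1 : E3) = x, ((γ t).2 : E3) = y at e₁ e₂ ⊢
  linear_combination
    (α + 1)⁻¹ * f (x 2) * g (y 2) ^ 2 * (deriv f (x 2) * ((y 0 ^ 2 + y 1 ^ 2) * e₁
      + (1 - x 2 ^ 2) * e₂) - f (x 2) * x 2 * e₂)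
    + α⁻¹ * g (y 2) * f (x 2) ^ 2 * (deriv g (y 2) * ((x 0 ^ 2 + x 1 ^ 2) * e₂
      + (1 - y 2 ^ 2) * e₁) - g (y 2) * y 2 * e₁)

theorem height_mem_Icc (p : S2) : (p : E3) 2 ∈ Icc (-1) 1 :=
  abs_le.1 (by simpa using PiLp.norm_apply_le (p : E3) 2)

/-- The two heights move along the line on which `(α + 1) z₁ - α z₂ = μ`. The assumption says that
they do so as harmonic oscillators of period `2`, so the time-one map reflects `α z₂` in `c`. -/
theorem hamIsotopic_of_probe {α : ℝ} (hα : 0 < α) {f g : ℝ → ℝ} (hf : ContDiff ℝ ∞ f)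
    (hg : ContDiff ℝ ∞ g) {μ c : ℝ}
    (h : ∀ z₁ ∈ Icc (-1 : ℝ) 1, ∀ z₂ ∈ Icc (-1 : ℝ) 1, (α + 1) * z₁ - α * z₂ = μ →
      deriv (profile f) z₁ * profile g z₂ / (α + 1) + profile f z₁ * deriv (profile g) z₂ / α
        = -2 * Real.pi ^ 2 * (α * z₂ - c)) (y : ℝ) :
    HamIsotopic α (splitTorus α (μ + y) y) (splitTorus α (μ + 2 * c - y) (2 * c - y)) := by
  have hf' : Differentiable ℝ f := hf.differentiable (by simp)
  have hg' : Differentiable ℝ g := hg.differentiable (by simp)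
  refine hamIsotopic_of_isFlowLine hα (contDiff_probeHamiltonian hf hg)
    (hasPartialGradients_probeHamiltonian hf' hg') fun γ (hγ : IsProbeFlowLine α f g γ) => ?_
  have hα1 : α + 1 ≠ 0 := by positivity
  have conserved (s t : ℝ) : (α + 1) * ((γ s).1 : E3) 2 - α * ((γ s).2 : E3) 2
      = (α + 1) * ((γ t).1 : E3) 2 - α * ((γ t).2 : E3) 2 :=
    is_const_of_hasDerivAt_zero (fun t =>
      ((hγ.hasDerivAt_fst hα1 t).sub (hγ.hasDerivAt_snd hα.ne' t)).congr_deriv (sub_self _)) s t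
  have reflected (t₀ : ℝ) (hμ : (α + 1) * ((γ t₀).1 : E3) 2 - α * ((γ t₀).2 : E3) 2 = μ) :
      α * ((γ 1).2 : E3) 2 - c = -(α * ((γ 0).2 : E3) 2 - c) :=
    apply_one_eq_neg_of_oscillator (fun t => (hγ.hasDerivAt_snd hα.ne' t).sub_const c)
      fun t => (hγ.hasDerivAt_probeVelocity hf' hg' t).congr_deriv <| by
        rw [h _ (height_mem_Icc _) _ (height_mem_Icc _) ((conserved t t₀).trans hμ)]
        ring
  rw [mem_splitTorus_iff hα, mem_splitTorus_iff hα]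
  have h01 := conserved 0 1
  constructor
  · rintro ⟨h₁, h₂⟩
    have := reflected 0 (by linarith)
    constructor <;> linarith
  · rintro ⟨h₁, h₂⟩
    have := reflected 1 (by linarith)
    constructor <;> linarith

theorem exists_contDiff_sq_mul_eq_one {δ : ℝ} (hδ : 0 < δ) :
    ∃ e : ℝ → ℝ, ContDiff ℝ ∞ e ∧ ∀ s, δ ≤ s → e s ^ 2 * s = 1 := by
  let e : ℝ → ℝ := fun s => Real.smoothTransition (2 * s / δ - 1) * (√s)⁻¹
  refine ⟨e, contDiff_iff_contDiffAt.2 fun s => ?_, fun s hs => ?_⟩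
  · rcases lt_or_ge s (δ / 2) with h | h
    · refine (contDiffAt_const (c := (0 : ℝ))).congr_of_eventuallyEq ?_
      filter_upwards [Iio_mem_nhds h] with r (hr : r < δ / 2)
      have : Real.smoothTransition (2 * r / δ - 1) = 0 :=
        Real.smoothTransition.zero_of_nonpos <| by
          rw [sub_nonpos, div_le_one hδ]
          linarith
      simp only [e, this, zero_mul]
    · have hs : 0 < s := by linarith
      exact (Real.smoothTransition.contDiff.contDiffAt.comp s (by fun_prop)).mul
        ((contDiffAt_id.sqrt hs.ne').inv (Real.sqrt_ne_zero'.2 hs))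
  · have h1 : Real.smoothTransition (2 * s / δ - 1) = 1 :=
      Real.smoothTransition.one_of_one_le <| by
        rw [le_sub_iff_add_le, le_div_iff₀ hδ]
        linarith
    have hs0 : 0 < s := hδ.trans_le hs
    simp only [e, h1, one_mul, inv_pow, Real.sq_sqrt hs0.le, inv_mul_cancel₀ hs0.ne']

theorem exists_contDiff_profile_eventuallyEq {φ ψ : ℝ → ℝ} (hφ : ContDiff ℝ ∞ φ) {k δ : ℝ}
    (hk : 0 ≤ k) (hδ : 0 < δ) (hφψ : ∀ z, φ z * ψ z = k * (1 - z ^ 2)) :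
    ∃ f : ℝ → ℝ, ContDiff ℝ ∞ f ∧ ∀ z, δ < φ z → profile f =ᶠ[𝓝 z] ψ := by
  obtain ⟨e, he, hinv⟩ := exists_contDiff_sq_mul_eq_one hδ
  refine ⟨fun z => √k * e (φ z), contDiff_const.mul (he.comp hφ), fun z hz => ?_⟩
  filter_upwards [hφ.continuous.continuousAt.eventually (lt_mem_nhds hz)] with w hw
  calc (√k * e (φ w)) ^ 2 * (1 - w ^ 2)
    _ = e (φ w) ^ 2 * (k * (1 - w ^ 2)) := by rw [mul_pow, Real.sq_sqrt hk]; ring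
    _ = e (φ w) ^ 2 * φ w * ψ w := by rw [← hφψ, mul_assoc]
    _ = ψ w := by rw [hinv _ hw.le, one_mul]

/-- The two heights move along a line of slope one that joins the top and the bottom of the moment
rectangle; the time-one map reflects this segment in its midpoint. -/
theorem hamIsotopic_shear {α : ℝ} (hα : 0 < α) {x y : ℝ} (h : |x - y| < 1) :
    HamIsotopic α (splitTorus α x y) (splitTorus α (x - 2 * y) (-y)) := by
  let m : ℝ := (|x - y| + α) / (α + 1)
  have hm : m < 1 := by rw [div_lt_one (by positivity)]; linarith
  have hm0 : 0 ≤ m := by positivity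
  have hδ : 0 < (1 - m ^ 2) / 2 := by nlinarith
  obtain ⟨f, hf, hprofile⟩ := exists_contDiff_profile_eventuallyEq
    (φ := fun z => 1 - z ^ 2) (ψ := fun _ => Real.pi ^ 2 * α ^ 2) (k := Real.pi ^ 2 * α ^ 2)
    (by fun_prop) (by positivity) hδ fun z => mul_comm _ _
  have hprofile_one : profile (fun _ => 1) = fun z => 1 - z ^ 2 := by ext; simp [profile]
  have h := hamIsotopic_of_probe hα hf (contDiff_const (c := 1)) (μ := x - y) (c := 0)
    (fun z₁ _ z₂ hz₂ hz => by
      have hz₁ : |z₁| ≤ m := by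
        rw [le_div_iff₀ (by positivity), ← abs_of_pos (show 0 < α + 1 by positivity), ← abs_mul,
          mul_comm, eq_add_of_sub_eq hz]
        refine (abs_add_le _ _).trans (add_le_add_right ?_ _)
        rw [abs_mul, abs_of_pos hα]
        exact mul_le_of_le_one_right hα.le (abs_le.2 hz₂)
      have hev := hprofile z₁ (by nlinarith [sq_abs z₁, abs_nonneg z₁])
      have hderiv : deriv (fun z : ℝ => 1 - z ^ 2) z₂ = -2 * z₂ := by simp
      rw [hev.deriv_eq, hev.eq_of_nhds, hprofile_one, deriv_const, hderiv]
      field_simp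
      ring) y
  convert h using 2 <;> ring

/-- The two heights move along a line of slope one that joins the right and the bottom side of the
moment rectangle; the time-one map reflects this segment in its midpoint. -/
theorem hamIsotopic_corner {α : ℝ} (hα : 0 < α) {x y : ℝ} (h : 1 < x - y) :
    HamIsotopic α (splitTorus α x y) (splitTorus α (1 - y) (1 - x)) := by
  have hδ₁ : 0 < 1 / (α + 1) := by positivity
  have hδ₂ : 0 < (x - y - 1) / (2 * α) := div_pos (by linarith) (by positivity)
  obtain ⟨f, hf, hprofile_f⟩ := exists_contDiff_profile_eventuallyEq
    (φ := fun z => 1 + z) (ψ := fun z => Real.pi ^ 2 * α * (α + 1) * (1 - z))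
    (k := Real.pi ^ 2 * α * (α + 1)) (by fun_prop) (by positivity) hδ₁ fun z => by ring
  obtain ⟨g, hg, hprofile_g⟩ := exists_contDiff_profile_eventuallyEq
    (φ := fun z => 1 - z) (ψ := fun z => 1 + z) (k := 1) (by fun_prop) zero_le_one hδ₂
    fun z => by ring
  have h := hamIsotopic_of_probe hα hf hg (μ := x - y) (c := (1 - (x - y)) / 2)
    (fun z₁ hz₁ z₂ hz₂ hz => by
      have hevf := hprofile_f z₁ (by
        rw [div_lt_iff₀ (by positivity)]
        nlinarith [hz₂.1])
      have hevg := hprofile_g z₂ (by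
        rw [div_lt_iff₀ (by positivity)]
        nlinarith [hz₁.2])
      have hdf : deriv (fun z => Real.pi ^ 2 * α * (α + 1) * (1 - z)) z₁
        = -(Real.pi ^ 2 * α * (α + 1)) := by simp
      have hdg : deriv (fun z : ℝ => 1 + z) z₂ = 1 := by simp
      rw [hevf.deriv_eq, hevf.eq_of_nhds, hevg.deriv_eq, hevg.eq_of_nhds, hdf, hdg]
      field_simp
      linear_combination -hz) y
  convert h using 2 <;> ring

/-! ### The orbit of `T(1, y)` -/

section Orbit

variable {α y : ℝ}

theorem hamIsotopic_reflect (hα : 0 < α) {s : ℝ} (hs : |s| < y) :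
    HamIsotopic α (splitTorus α (1 + s) y) (splitTorus α (1 - s) y) := by
  obtain ⟨h₁, h₂⟩ := abs_lt.1 hs
  have swap {a b : ℝ} (h : 1 < a + b) :
      HamIsotopic α (splitTorus α a b) (splitTorus α (1 + b) (a - 1)) := by
    have := ((hamIsotopic_neg_right hα a b).trans
      (hamIsotopic_corner hα (by linarith))).trans (hamIsotopic_neg_right hα _ _)
    convert this using 2 <;> ring
  have := ((hamIsotopic_neg_right hα (1 + s) y).trans
    (hamIsotopic_corner hα (by linarith))).trans (swap (by linarith))
  convert this using 2 <;> ring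

theorem hamIsotopic_translate_right (hα : 0 < α) {x : ℝ} (hx : |x + y| < 1) :
    HamIsotopic α (splitTorus α x y) (splitTorus α (x + 2 * y) y) := by
  have hx' : |-x - y| < 1 := by rwa [← neg_add', abs_neg]
  have := (((hamIsotopic_neg_left hα x y).trans (hamIsotopic_shear hα hx')).trans
    (hamIsotopic_neg_left hα _ _)).trans (hamIsotopic_neg_right hα _ _)
  convert this using 2 <;> ring

theorem hamIsotopic_translate_nat (hα : 0 < α) (hy : 0 < y) {x : ℝ} (m : ℕ) (hx : -1 - y < x)
    (hxm : x + 2 * y * m < 1 + y) :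
    HamIsotopic α (splitTorus α x y) (splitTorus α (x + 2 * y * m) y) := by
  induction m with
  | zero => simpa using HamIsotopic.refl α (splitTorus α x y)
  | succ m ih =>
    push_cast at hxm ⊢
    have hm : 0 ≤ 2 * y * m := by positivity
    have := (ih (by linarith)).trans <|
      hamIsotopic_translate_right hα (abs_lt.2 ⟨by linarith, by linarith⟩)
    convert this using 2
    ring

theorem hamIsotopic_translate_int (hα : 0 < α) (hy : 0 < y) {x : ℝ} (m : ℤ) (hx : |x| < 1 + y)
    (hxm : |x + 2 * y * m| < 1 + y) :
    HamIsotopic α (splitTorus α x y) (splitTorus α (x + 2 * y * m) y) := by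
  obtain ⟨h₁, h₂⟩ := abs_lt.1 hx
  obtain ⟨h₁', h₂'⟩ := abs_lt.1 hxm
  obtain ⟨n, rfl | rfl⟩ := m.eq_nat_or_neg <;> push_cast at h₁' h₂' ⊢
  · exact hamIsotopic_translate_nat hα hy n (by linarith) h₂'
  · have := ((hamIsotopic_neg_left hα x y).trans
      (hamIsotopic_translate_nat hα hy n (by linarith) (by linarith))).trans
      (hamIsotopic_neg_left hα _ _)
    convert this using 2
    ring

theorem hamIsotopic_add_two (hα : 0 < α) {s : ℝ} (m : ℤ) (hs : |s| < y)
    (hsm : |s + 2 + 2 * y * m| < y) :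
    HamIsotopic α (splitTorus α (1 + s) y) (splitTorus α (1 + (s + 2 + 2 * y * m)) y) := by
  have hy : 0 < y := (abs_nonneg s).trans_lt hs
  obtain ⟨h₁, h₂⟩ := abs_lt.1 hs
  obtain ⟨h₁', h₂'⟩ := abs_lt.1 hsm
  have htranslate := hamIsotopic_translate_int hα hy (x := -(1 + s)) (-m)
    (by rw [abs_lt]; constructor <;> linarith)
    (by rw [abs_lt]; push_cast; constructor <;> linarith)
  have hreflect := hamIsotopic_reflect hα (s := -(s + 2 + 2 * y * m)) (by rwa [abs_neg])
  rw [show 1 + -(s + 2 + 2 * y * m) = -(1 + s) + 2 * y * (-m : ℤ) by push_cast; ring,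
    sub_neg_eq_add] at hreflect
  exact ((hamIsotopic_neg_left hα _ _).trans htranslate).trans hreflect

theorem abs_sub_round_lt_half_of_irrational {x : ℝ} (hx : Irrational x) :
    |x - round x| < 1 / 2 := by
  refine (abs_sub_round x).lt_of_ne fun h => ?_
  have hirr := hx.sub_intCast (round x)
  rcases eq_or_eq_neg_of_abs_eq h with h | h
  · exact hirr.ne_rational 1 2 (by rw [h]; norm_num)
  · exact hirr.ne_rational (-1) 2 (by rw [h]; norm_num)

theorem exists_abs_add_int_mul_lt (hy : 0 < y) (hirr : Irrational y) (n : ℕ) :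
    ∃ k : ℤ, |2 * n + 2 * y * k| < y := by
  rcases Nat.eq_zero_or_pos n with rfl | hn
  · exact ⟨0, by simpa using hy⟩
  have h := abs_sub_round_lt_half_of_irrational (hirr.natCast_div hn.ne')
  refine ⟨-round (n / y), ?_⟩
  calc |2 * n + 2 * y * (-round (n / y) : ℤ)|
    _ = |2 * y * (n / y - round (n / y))| := by congr 1; push_cast; field_simp; ring
    _ = 2 * y * |n / y - round (n / y)| := by rw [abs_mul, abs_of_pos (by positivity)]
    _ < 2 * y * (1 / 2) := by gcongr
    _ = y := by ring

theorem hamIsotopic_orbit_nat (hα : 0 < α) (hy : 0 < y) (hirr : Irrational y) (n : ℕ) (k : ℤ)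
    (hk : |2 * n + 2 * y * k| < y) :
    HamIsotopic α (splitTorus α 1 y) (splitTorus α (1 + (2 * n + 2 * y * k)) y) := by
  induction n generalizing k with
  | zero =>
    have h₁ : |(1 : ℝ)| < 1 + y := by rw [abs_one]; linarith
    have h₂ : |1 + 2 * y * k| < 1 + y := (abs_add_le _ _).trans_lt (by simpa using hk)
    simpa using hamIsotopic_translate_int hα hy k h₁ h₂
  | succ n ih =>
    obtain ⟨k₀, hk₀⟩ := exists_abs_add_int_mul_lt hy hirr n
    have e : 2 * n + 2 * y * k₀ + 2 + 2 * y * (k - k₀ : ℤ) = 2 * (n + 1 : ℕ) + 2 * y * k := by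
      push_cast
      ring
    have := (ih k₀ hk₀).trans (hamIsotopic_add_two hα (k - k₀) hk₀ (by rwa [e]))
    rwa [e] at this

theorem hamIsotopic_orbit (hα : 0 < α) (hy : 0 < y) (hirr : Irrational y) {s : ℝ}
    (hs : s ∈ AddSubgroup.closure {2, 2 * y}) (hsy : |s| < y) :
    HamIsotopic α (splitTorus α 1 y) (splitTorus α (1 + s) y) := by
  obtain ⟨m, k, rfl⟩ := AddSubgroup.mem_closure_pair.1 hs
  obtain ⟨n, rfl | rfl⟩ := m.eq_nat_or_neg
  · have e : (n : ℤ) • (2 : ℝ) + k • (2 * y) = 2 * n + 2 * y * k := by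
      simp only [zsmul_eq_mul, Int.cast_natCast]
      ring
    rw [e] at hsy ⊢
    exact hamIsotopic_orbit_nat hα hy hirr n k hsy
  · have e : -(n : ℤ) • (2 : ℝ) + k • (2 * y) = -(2 * n + 2 * y * (-k : ℤ)) := by
      simp only [zsmul_eq_mul, Int.cast_natCast, Int.cast_neg]
      ring
    rw [e] at hsy ⊢
    rw [abs_neg] at hsy
    exact (hamIsotopic_orbit_nat hα hy hirr n (-k) hsy).trans (hamIsotopic_reflect hα hsy)

end Orbit

theorem infinite_inter_of_dense {X : Type*} [TopologicalSpace X] [T1Space X]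
    [∀ x : X, (𝓝[≠] x).NeBot] {G U : Set X} (hG : Dense G) (hU : IsOpen U) (hne : U.Nonempty) :
    (U ∩ G).Infinite := fun hfin => by
  obtain ⟨x, hx, hxG, hxn⟩ := (hG.sdiff_finite hfin).inter_open_nonempty U hU hne
  exact hxn ⟨hx, hxG⟩

theorem dense_closure_two_two_mul {y : ℝ} (hirr : Irrational y) :
    Dense (AddSubgroup.closure {2, 2 * y} : Set ℝ) := by
  rw [dense_addSubgroupClosure_pair_iff, div_mul_cancel_left₀ two_ne_zero]
  exact hirr.inv

theorem IsWeinsteinNhd.isOpen {α : ℝ} {L W : Set S2xS2} (h : IsWeinsteinNhd α L W) : IsOpen W := by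
  obtain ⟨_, _, -, -, -, -, -, -, -, hW⟩ := h
  exact hW

theorem IsWeinsteinNhd.subset {α : ℝ} {L W : Set S2xS2} (h : IsWeinsteinNhd α L W) : L ⊆ W := by
  obtain ⟨_, _, -, hV, -, -, -, rfl, rfl, -⟩ := h
  exact image_mono hV

theorem infinite_image_splitTorus {α y : ℝ} (hα : 0 < α) (hy : y < α) {S : Set ℝ}
    (hS : S.Infinite) (hSy : ∀ s ∈ S, |s| < y) :
    ((fun s => splitTorus α (1 + s) y) '' S).Infinite := by
  refine hS.image fun s hs s' _ h => ?_
  by_contra hne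
  have hy0 := (abs_nonneg s).trans_lt (hSy s hs)
  have hnonempty : (splitTorus α (1 + s) y).Nonempty :=
    splitTorus_nonempty hα ((abs_add_le _ _).trans (by rw [abs_one]; linarith [hSy s hs]))
      (by rw [abs_of_pos hy0]; exact hy.le)
  exact hnonempty.ne_empty <| (disjoint_splitTorus hα (by simpa using hne) y y).eq_bot_of_le h.le

theorem corollary1p4_general (α : ℝ) (hα : 0 < α) :
    ∃ L : Set S2xS2, IsSplitTorus α L ∧
      ∀ W : Set S2xS2, IsOpen W → L ⊆ W →
        {L' : Set S2xS2 | IsSplitTorus α L' ∧ L' ⊆ W ∧ HamIsotopic α L L' ∧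
          L ∩ L' = ∅}.Infinite := by
  obtain ⟨y, hirr, hy, hyα⟩ := exists_irrational_btwn hα
  have isSplitTorus {s : ℝ} (hs : |s| < y) : IsSplitTorus α (splitTorus α (1 + s) y) := by
    obtain ⟨h₁, h₂⟩ := abs_lt.1 hs
    exact ⟨_, ⟨by linarith, by linarith⟩, _, ⟨by linarith, hyα⟩, rfl⟩
  refine ⟨splitTorus α 1 y, by simpa using isSplitTorus (s := 0) (by simpa), fun W hW hLW => ?_⟩
  let U : Set ℝ := {s | splitTorus α (1 + s) y ⊆ W} ∩ {s | |s| < y}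
  have hU : IsOpen U := ((isOpen_setOf_splitTorus_subset hα hW).preimage
    (show Continuous fun s : ℝ => (1 + s, y) by fun_prop)).inter
      (isOpen_lt continuous_abs continuous_const)
  have hU0 : (0 : ℝ) ∈ U := ⟨by simpa using hLW, by simpa using hy⟩
  have hS := (infinite_inter_of_dense (dense_closure_two_two_mul hirr) hU ⟨0, hU0⟩).sdiff
    (finite_singleton 0)
  refine (infinite_image_splitTorus hα hyα hS fun s hs => hs.1.1.2).mono ?_
  rintro _ ⟨s, ⟨⟨⟨hsW, hsy⟩, hs⟩, hs0⟩, rfl⟩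
  exact ⟨isSplitTorus hsy, hsW, hamIsotopic_orbit hα hy hirr hs hsy,
    (disjoint_splitTorus hα (by simpa using hs0) y y).inter_eq⟩

end

theorem corollary1p4 (α : ℝ) (hα : 0 < α) :
    ∃ L : Set S2xS2, IsSplitTorus α L ∧
      ∀ W : Set S2xS2, IsWeinsteinNhd α L W →
        {L' : Set S2xS2 | IsSplitTorus α L' ∧ L' ⊆ W ∧ HamIsotopic α L L' ∧
          L ∩ L' = ∅}.Infinite := by
  obtain ⟨L, hL, h⟩ := corollary1p4_general α hα
  exact ⟨L, hL, fun W hW => h W hW.isOpen hW.subset⟩
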